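/- For a small preadditive category $\mathscr R$, let $\mathcal M_{\mathscr R}$ be the category of right $\mathscr R$-modules, i.e. of additive functors $\mathscr R^{op}\to\mathbf{Ab}$. For right and left $\mathscr R$-modules $\mathscr M:\mathscr R^{op}\to\mathbf{Ab}$ and $\mathscr N:\mathscr R\to\mathbf{Ab}$, let $\mathscr M\otimes_{\mathscr R}\mathscr N$ be the quotient of $\bigoplus_{a}\mathscr M(a)\otimes_{\mathbb Z}\mathscr N(a)$ by the subgroup generated by the elements $\mathscr M(r)(x)\otimes y-x\otimes\mathscr N(r)(y)$ for $r\in\mathscr R(a,b)$, $x\in\mathscr M(b)$, $y\in\mathscr N(a)$. An additive functor $\phi:\mathscr R\to\mathscr S$ of small preadditive categories induces the restriction of scalars $\phi_*:\mathcal M_{\mathscr S}\to\mathcal M_{\mathscr R}$, $\mathscr N\mapsto \mathscr N\circ\phi$, and the extension of scalars $\phi^*:\mathcal M_{\mathscr R}\to\mathcal M_{\mathscr S}$, $\mathscr M\mapsto\mathscr M\otimes_{\mathscr R}\mathscr S(-,\phi(-))$. For small preadditive categories $\mathscr R,\mathscr Q$, an $(\mathscr R,\mathscr Q)$-bimodule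 is an additive functor $\mathscr Q^{op}\otimes\mathscr R\to\mathbf{Ab}$, where $\mathscr Q^{op}\otimes\mathscr R$ has the pairs of objects as objects and the tensor products over $\mathbb Z$ of the groups of morphisms as groups of morphisms; morphisms of bimodules are natural transformations. Given functors $F:\mathcal C\to\mathcal D$ and $I:\mathcal C\to\mathcal X$, the functor $F$ is called heavily $I$-separable if there is a natural transformation $P:\mathcal D(F(-),F(-))\to\mathcal X(I(-),I(-))$ of functors $\mathcal C^{op}\times\mathcal C\to\mathbf{Set}$ such that $P_{a,b}(F(f))=I(f)$ for every $f\in\mathcal C(a,b)$, and $P_{a,c}(g\circ f)=P_{b,c}(g)\circ P_{a,b}(f)$ for all objects $a,b,c$ of $\mathcal C$ and all $f\in\mathcal D(Fa,Fb)$, $g\in\mathcal D(Fb,Fc)$. **Theorem.** Let $\mathscr Q\xrightarrow{\psi}\mathscr R\xrightarrow{\phi}\mathscr S$ be additive functors between small preadditive categories. Then $\phi^*:\mathcal M_{\mathscr R}\to\mathcal M_{\mathscr S}$ is heavily $\psi_*$-separable, where $\psi_*:\mathcal M_{\mathscr R}\to\mathcal M_{\mathscr Q}$, if and only if there is a morphism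 $$\alpha:\mathscr S(\phi(\psi(-)),\phi(-))\longrightarrow\mathscr R(\psi(-),-)$$ of $(\mathscr R,\mathscr Q)$-bimodules such that 1. $\alpha\circ\phi_{\psi(-),-}=\mathrm{id}$, where $\phi_{\psi(-),-}:\mathscr R(\psi(-),-)\to\mathscr S(\phi(\psi(-)),\phi(-))$ is the morphism of $(\mathscr R,\mathscr Q)$-bimodules induced by $\phi$; and 2. for all $a\in\mathscr Q$, $b,c\in\mathscr R$, $f\in\mathscr S(\phi(\psi(a)),\phi(b))$ and $g\in\mathscr S(\phi(b),\phi(c))$, $$\alpha_{a,c}(g\circ f)=\alpha_{a,c}\bigl(g\circ\phi(\alpha_{a,b}(f))\bigr).$$ -/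

import Mathlib

open CategoryTheory Opposite
open scoped TensorProduct

universe u v v₁ u₁ u₂ u₃

noncomputable section

namespace HeavySep

/-! ### Heavily `I`-separable functors -/

/-- `F : C ⥤ D` is heavily `I`-separable, for `I : C ⥤ X`, if there is a natural transformation
`P : D(F(-), F(-)) ⟶ X(I(-), I(-))` of functors `Cᵒᵖ × C ⥤ Type` such that `P (F f) = I f` for
every morphism `f` of `C`, and such that `P` is compatible with composition. -/
def IsHeavilySeparable {C : Type u₁} [Category.{v₁} C] {D : Type u₂} [Category.{v} D]
    {X : Type u₃} [Category.{v} X] (F : C ⥤ D) (I : C ⥤ X) : Prop :=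
  ∃ P : F.op.prod F ⋙ Functor.hom D ⟶ I.op.prod I ⋙ Functor.hom X,
    (∀ (a b : C) (f : a ⟶ b),
      (P.app (op a, b) (F.map f : F.obj a ⟶ F.obj b) : I.obj a ⟶ I.obj b) = I.map f) ∧
    ∀ (a b c : C) (f : F.obj a ⟶ F.obj b) (g : F.obj b ⟶ F.obj c),
      (P.app (op a, c) (f ≫ g : F.obj a ⟶ F.obj c) : I.obj a ⟶ I.obj c) =
        (P.app (op a, b) f : I.obj a ⟶ I.obj b) ≫ (P.app (op b, c) g : I.obj b ⟶ I.obj c)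

/-! ### Modules over a small preadditive category -/

/-- Right modules over `R`: additive functors `Rᵒᵖ ⥤ Ab`. -/
abbrev RightMod (R : Type u) [SmallCategory R] [Preadditive R] :=
  Rᵒᵖ ⥤+ AddCommGrpCat.{u}

/-- Left modules over `R`: additive functors `R ⥤ Ab`. -/
abbrev LeftMod (R : Type u) [SmallCategory R] [Preadditive R] :=
  R ⥤+ AddCommGrpCat.{u}

section Tensor

variable {R : Type u} [SmallCategory R] [Preadditive R]

open Classical in
/-- The element `x ⊗ y` of the summand indexed by `a` in `⨁ a, M(a) ⊗ N(a)`. -/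
def preTmul (M : RightMod R) (N : LeftMod R) (a : R) (x : M.obj.obj (op a)) (y : N.obj.obj a) :
    DirectSum R (fun a => M.obj.obj (op a) ⊗[ℤ] N.obj.obj a) :=
  DirectSum.of (fun a => M.obj.obj (op a) ⊗[ℤ] N.obj.obj a) a (x ⊗ₜ[ℤ] y)

/-- The subgroup of `⨁ a, M(a) ⊗ N(a)` generated by the elements `M(r)(x) ⊗ y - x ⊗ N(r)(y)`. -/
def tensorRel (M : RightMod R) (N : LeftMod R) :
    AddSubgroup (DirectSum R (fun a => M.obj.obj (op a) ⊗[ℤ] N.obj.obj a)) :=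
  AddSubgroup.closure {z | ∃ (a b : R) (r : a ⟶ b) (x : M.obj.obj (op b)) (y : N.obj.obj a),
    z = preTmul M N a (M.obj.map r.op x) y - preTmul M N b x (N.obj.map r y)}

/-- The tensor product `M ⊗_R N` of a right module and a left module. -/
abbrev Tensor (M : RightMod R) (N : LeftMod R) : Type u :=
  DirectSum R (fun a => M.obj.obj (op a) ⊗[ℤ] N.obj.obj a) ⧸ tensorRel M N

/-- The class of `x ⊗ y` in `M ⊗_R N`, for `x ∈ M(a)` and `y ∈ N(a)`. -/
def tmul (M : RightMod R) (N : LeftMod R) (a : R) (x : M.obj.obj (op a)) (y : N.obj.obj a) :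
    Tensor M N :=
  QuotientAddGroup.mk' (tensorRel M N) (preTmul M N a x y)

variable {M M' M'' : RightMod R} {N N' N'' : LeftMod R}

lemma tmul_add_right (a : R) (x : M.obj.obj (op a)) (y y' : N.obj.obj a) :
    tmul M N a x (y + y') = tmul M N a x y + tmul M N a x y' := by
  simp only [tmul, preTmul, TensorProduct.tmul_add, map_add]

lemma tmul_balanced {a b : R} (r : a ⟶ b) (x : M.obj.obj (op b)) (y : N.obj.obj a) :
    tmul M N a (M.obj.map r.op x) y = tmul M N b x (N.obj.map r y) := by
  rw [← sub_eq_zero, tmul, tmul, ← map_sub]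
  exact (QuotientAddGroup.eq_zero_iff _).2 (AddSubgroup.subset_closure ⟨a, b, r, x, y, rfl⟩)

/-- Additive maps out of `M ⊗_R N` are determined by their values on pure tensors. -/
lemma tensor_hom_ext {A : Type*} [AddCommGroup A] {p q : Tensor M N →+ A}
    (h : ∀ a x y, p (tmul M N a x y) = q (tmul M N a x y)) : p = q := by
  classical
  apply QuotientAddGroup.addMonoidHom_ext
  apply DirectSum.addHom_ext'
  intro a
  ext z
  induction z using TensorProduct.induction_on with
  | zero => simp
  | tmul x y =>
    have := h a x y
    simp only [tmul, preTmul] at this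
    simp only [AddMonoidHom.comp_apply]
    convert this
  | add z w hz hw => simp only [map_add, hz, hw]

/-- The map `M ⊗_R N ⟶ M' ⊗_R N'` induced by morphisms of modules `M ⟶ M'` and `N ⟶ N'`. -/
def tensorMap (p : M ⟶ M') (q : N ⟶ N') : Tensor M N →+ Tensor M' N' :=
  QuotientAddGroup.map (tensorRel M N) (tensorRel M' N')
    (DirectSum.map (fun a => (TensorProduct.map (p.hom.app (op a)).hom.toIntLinearMap
      (q.hom.app a).hom.toIntLinearMap).toAddMonoidHom)) (by
    rw [tensorRel, AddSubgroup.closure_le]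
    rintro _ ⟨a, b, r, x, y, rfl⟩
    refine AddSubgroup.subset_closure
      ⟨a, b, r, p.hom.app (op b) x, q.hom.app a y, ?_⟩
    have h₁ : p.hom.app (op a) (M.obj.map r.op x) = M'.obj.map r.op (p.hom.app (op b) x) :=
      ConcreteCategory.congr_hom (p.hom.naturality r.op) x
    have h₂ : q.hom.app b (N.obj.map r y) = N'.obj.map r (q.hom.app a y) :=
      ConcreteCategory.congr_hom (q.hom.naturality r) y
    rw [← h₁, ← h₂, map_sub]
    simp only [preTmul, DirectSum.map_of]
    rfl)

@[simp]
lemma tensorMap_tmul (p : M ⟶ M') (q : N ⟶ N') (a : R) (x : M.obj.obj (op a))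
    (y : N.obj.obj a) :
    tensorMap p q (tmul M N a x y) =
      tmul M' N' a (p.hom.app (op a) x) (q.hom.app a y) := by
  simp only [tensorMap, tmul, preTmul, QuotientAddGroup.mk'_apply, QuotientAddGroup.map_mk,
    DirectSum.map_of]
  rfl

lemma tensorMap_id : tensorMap (𝟙 M) (𝟙 N) = AddMonoidHom.id _ :=
  tensor_hom_ext fun a x y => by simp

lemma tensorMap_comp (p : M ⟶ M') (p' : M' ⟶ M'') (q : N ⟶ N') (q' : N' ⟶ N'') :
    tensorMap (p ≫ p') (q ≫ q') = (tensorMap p' q').comp (tensorMap p q) :=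
  tensor_hom_ext fun a x y => by simp

lemma tensorMap_add_right (p : M ⟶ M') (q q' : N ⟶ N') :
    tensorMap p (q + q') = tensorMap p q + tensorMap p q' :=
  tensor_hom_ext fun a x y => by
    rw [AddMonoidHom.add_apply, tensorMap_tmul, tensorMap_tmul, tensorMap_tmul,
      ← tmul_add_right]
    rfl

end Tensor

/-! ### Restriction and extension of scalars -/

section Scalars

variable {R S : Type u} [SmallCategory R] [Preadditive R] [SmallCategory S] [Preadditive S]

/-- Restriction of scalars `φ_* : M_S ⥤ M_R`, i.e. composition with `φ`. -/
def restrictScalars (φ : R ⥤ S) [φ.Additive] : RightMod S ⥤ RightMod R where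
  obj M := AdditiveFunctor.of (φ.op ⋙ M.obj)
  map p := ObjectProperty.homMk (Functor.whiskerLeft φ.op p.hom)

/-- The left `R`-module `S(s, φ(-))`. -/
def homLeft (φ : R ⥤ S) [φ.Additive] (s : S) : LeftMod R where
  obj :=
    { obj := fun r => AddCommGrpCat.of (s ⟶ φ.obj r)
      map := fun g => AddCommGrpCat.ofHom (Preadditive.rightComp s (φ.map g))
      map_id := fun r => by
        ext h
        change h ≫ φ.map (𝟙 r) = h
        simp
      map_comp := fun {a b c} f g => by
        ext h
        change h ≫ φ.map (f ≫ g) = (h ≫ φ.map f) ≫ φ.map g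
        simp }
  property := ⟨fun {a b f g} => by
    ext h
    change h ≫ φ.map (f + g) = h ≫ φ.map f + h ≫ φ.map g
    simp⟩

/-- The morphism of left `R`-modules `S(s, φ(-)) ⟶ S(t, φ(-))` given by composition with
`h : t ⟶ s`. -/
def homLeftMap (φ : R ⥤ S) [φ.Additive] {s t : S} (h : t ⟶ s) : homLeft φ s ⟶ homLeft φ t :=
  ObjectProperty.homMk
    { app := fun r => AddCommGrpCat.ofHom (Preadditive.leftComp (φ.obj r) h)
      naturality := fun _ _ g => by ext k; exact (Category.assoc h _ (φ.map g)).symm }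

lemma homLeftMap_id (φ : R ⥤ S) [φ.Additive] (s : S) : homLeftMap φ (𝟙 s) = 𝟙 _ := by
  ext r k; exact Category.id_comp _

lemma homLeftMap_comp (φ : R ⥤ S) [φ.Additive] {s t w : S} (h : t ⟶ s) (k : w ⟶ t) :
    homLeftMap φ (k ≫ h) = homLeftMap φ h ≫ homLeftMap φ k := by
  ext r l; exact Category.assoc _ _ _

lemma homLeftMap_add (φ : R ⥤ S) [φ.Additive] {s t : S} (h k : t ⟶ s) :
    homLeftMap φ (h + k) = homLeftMap φ h + homLeftMap φ k := by
  ext r l; exact Preadditive.add_comp _ _ _ _ _ _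

/-- The right `S`-module `M ⊗_R S(-, φ(-))`. -/
def extendScalarsObj (φ : R ⥤ S) [φ.Additive] (M : RightMod R) : RightMod S where
  obj :=
    { obj := fun s => AddCommGrpCat.of (Tensor M (homLeft φ s.unop))
      map := fun h => AddCommGrpCat.ofHom (tensorMap (𝟙 M) (homLeftMap φ h.unop))
      map_id := fun s => by
        rw [unop_id, homLeftMap_id, tensorMap_id]; rfl
      map_comp := fun h k => by
        rw [unop_comp, homLeftMap_comp, ← Category.comp_id (𝟙 M), tensorMap_comp]
        simp }
  property := ⟨fun {_ _ f g} => by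
    refine (congrArg AddCommGrpCat.ofHom ?_ :
      AddCommGrpCat.ofHom (tensorMap (𝟙 M) (homLeftMap φ (f + g).unop)) =
        AddCommGrpCat.ofHom (tensorMap (𝟙 M) (homLeftMap φ f.unop) +
          tensorMap (𝟙 M) (homLeftMap φ g.unop)))
    rw [unop_add, homLeftMap_add, tensorMap_add_right]⟩

/-- Extension of scalars `φ^* : M_R ⥤ M_S`, `M ↦ M ⊗_R S(-, φ(-))`. -/
def extendScalars (φ : R ⥤ S) [φ.Additive] : RightMod R ⥤ RightMod S where
  obj M := extendScalarsObj φ M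
  map p := ObjectProperty.homMk
    { app := fun s => AddCommGrpCat.ofHom (tensorMap p (𝟙 (homLeft φ s.unop)))
      naturality := fun s t h => by
        simp only [extendScalarsObj, ← AddCommGrpCat.ofHom_comp, ← tensorMap_comp,
          Category.id_comp, Category.comp_id] }
  map_id M := by
    ext s : 3
    exact congrArg AddCommGrpCat.ofHom tensorMap_id
  map_comp p q := by
    ext s : 3
    refine (congrArg AddCommGrpCat.ofHom ?_ :
      AddCommGrpCat.ofHom (tensorMap (p ≫ q) (𝟙 (homLeft φ s.unop))) =
        AddCommGrpCat.ofHom ((tensorMap q (𝟙 (homLeft φ s.unop))).comp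
          (tensorMap p (𝟙 (homLeft φ s.unop)))))
    rw [← tensorMap_comp, Category.comp_id]

end Scalars

/-! ### Tensor products of preadditive categories, and bimodules -/

/-- The tensor product `A ⊗ B` of two preadditive categories: the objects are pairs. -/
structure TensorCat (A B : Type u) where
  /-- The first component. -/
  left : A
  /-- The second component. -/
  right : B

section TensorCat

variable {A B : Type u} [SmallCategory A] [Preadditive A] [SmallCategory B] [Preadditive B]

/-- Composition is determined by `(f ⊗ g) ≫ (f' ⊗ g') = (f ≫ f') ⊗ (g ≫ g')`. -/
instance : SmallCategory (TensorCat A B) where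
  Hom X Y := (X.left ⟶ Y.left) ⊗[ℤ] (X.right ⟶ Y.right)
  id X := 𝟙 X.left ⊗ₜ 𝟙 X.right
  comp {X Y Z} f g := TensorProduct.map₂ (Linear.comp (S := ℤ) X.left Y.left Z.left)
    (Linear.comp (S := ℤ) X.right Y.right Z.right) f g
  id_comp {X Y} f := by
    induction f using TensorProduct.induction_on with
    | zero => simp
    | tmul f g => simp [TensorProduct.map₂_apply_tmul]
    | add f g hf hg => rw [map_add, hf, hg]
  comp_id {X Y} f := by
    induction f using TensorProduct.induction_on with
    | zero => simp
    | tmul f g => simp [TensorProduct.map₂_apply_tmul]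
    | add f g hf hg => rw [map_add, LinearMap.add_apply, hf, hg]
  assoc {W X Y Z} f g h := by
    induction f using TensorProduct.induction_on with
    | zero => simp
    | add f f' hf hf' => simp only [map_add, LinearMap.add_apply, hf, hf']
    | tmul f f' =>
      induction g using TensorProduct.induction_on with
      | zero => simp
      | add g g' hg hg' => simp only [map_add, LinearMap.add_apply, hg, hg']
      | tmul g g' =>
        induction h using TensorProduct.induction_on with
        | zero => simp
        | add h h' hh hh' => simp only [map_add, hh, hh']
        | tmul h h' => simp [TensorProduct.map₂_apply_tmul]

instance : Preadditive (TensorCat A B) where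
  homGroup X Y := inferInstanceAs (AddCommGroup ((X.left ⟶ Y.left) ⊗[ℤ] (X.right ⟶ Y.right)))
  add_comp X Y Z f f' g := by
    change TensorProduct.map₂ _ _ (_ + _) _ = _
    rw [map_add]; rfl
  comp_add X Y Z f g g' := by
    change TensorProduct.map₂ _ _ _ (_ + _) = _
    rw [map_add]; rfl

end TensorCat

section Bimod

variable {Q R S : Type u} [SmallCategory Q] [Preadditive Q] [SmallCategory R] [Preadditive R]
  [SmallCategory S] [Preadditive S]

/-- `(R, Q)`-bimodules: left modules over `Qᵒᵖ ⊗ R`. -/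
abbrev Bimod (R Q : Type u) [SmallCategory R] [Preadditive R] [SmallCategory Q]
    [Preadditive Q] :=
  LeftMod (TensorCat Qᵒᵖ R)

/-- For `F : Q ⥤ S` and `G : R ⥤ S`, the additive map sending `f ⊗ g`, where `f : a' ⟶ a` in `Q`
and `g : b ⟶ b'` in `R`, to the map `h ↦ F(f) ≫ h ≫ G(g)` from `S(F(a), G(b))` to
`S(F(a'), G(b'))`. -/
def homBimodAct (F : Q ⥤ S) (G : R ⥤ S) [F.Additive] [G.Additive] (X Y : TensorCat Qᵒᵖ R) :
    (X.left ⟶ Y.left) ⊗[ℤ] (X.right ⟶ Y.right) →ₗ[ℤ]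
      (F.obj X.left.unop ⟶ G.obj X.right) →ₗ[ℤ] (F.obj Y.left.unop ⟶ G.obj Y.right) :=
  TensorProduct.lift (LinearMap.mk₂ ℤ
    (fun f g => Linear.leftComp ℤ _ (F.map f.unop) ∘ₗ Linear.rightComp ℤ _ (G.map g))
    (fun f f' g => by ext h; simp)
    (fun n f g => by ext h; simp)
    (fun f g g' => by ext h; simp)
    (fun n f g => by ext h; simp))

@[simp]
lemma homBimodAct_tmul (F : Q ⥤ S) (G : R ⥤ S) [F.Additive] [G.Additive]
    (X Y : TensorCat Qᵒᵖ R) (f : X.left ⟶ Y.left) (g : X.right ⟶ Y.right)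
    (h : F.obj X.left.unop ⟶ G.obj X.right) :
    homBimodAct F G X Y (f ⊗ₜ g) h = F.map f.unop ≫ h ≫ G.map g := rfl

/-- The `(R, Q)`-bimodule `S(F(-), G(-))`, for `F : Q ⥤ S` and `G : R ⥤ S`. -/
def homBimod (F : Q ⥤ S) (G : R ⥤ S) [F.Additive] [G.Additive] : Bimod R Q where
  obj :=
    { obj := fun X => AddCommGrpCat.of (F.obj X.left.unop ⟶ G.obj X.right)
      map := fun {X Y} t => AddCommGrpCat.ofHom (homBimodAct F G X Y t).toAddMonoidHom
      map_id := fun X => by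
        ext h
        change homBimodAct F G X X (𝟙 X.left ⊗ₜ 𝟙 X.right) h = h
        simp
      map_comp := fun {X Y Z} s t => by
        ext h
        change homBimodAct F G X Z (TensorProduct.map₂ _ _ s t) h =
          homBimodAct F G Y Z t (homBimodAct F G X Y s h)
        induction s using TensorProduct.induction_on with
        | zero => simp
        | add s s' hs hs' => simp only [map_add, LinearMap.add_apply, hs, hs']
        | tmul f g =>
          induction t using TensorProduct.induction_on with
          | zero => simp
          | add t t' ht ht' => simp only [map_add, LinearMap.add_apply, ht, ht']
          | tmul f' g' => simp [TensorProduct.map₂_apply_tmul] }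
  property := ⟨fun {X Y s t} => by
    ext h
    change homBimodAct F G X Y (s + t) h = homBimodAct F G X Y s h + homBimodAct F G X Y t h
    rw [map_add, LinearMap.add_apply]⟩

/-- The component at `(a, b)` of a morphism of bimodules of the form `S(F(-), G(-))`. -/
def bimodApp {S' : Type u} [SmallCategory S'] [Preadditive S'] {F : Q ⥤ S} {G : R ⥤ S}
    {F' : Q ⥤ S'} {G' : R ⥤ S'} [F.Additive] [G.Additive] [F'.Additive] [G'.Additive]
    (α : homBimod F G ⟶ homBimod F' G') (a : Q) (b : R) (h : F.obj a ⟶ G.obj b) :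
    F'.obj a ⟶ G'.obj b :=
  (α.hom.app ⟨op a, b⟩).hom h

/-- The morphism `φ_{ψ(-),-} : R(ψ(-), -) ⟶ S(φ(ψ(-)), φ(-))` of `(R, Q)`-bimodules. -/
def mapBimod (ψ : Q ⥤ R) (φ : R ⥤ S) [ψ.Additive] [φ.Additive] :
    homBimod ψ (𝟭 R) ⟶ homBimod (ψ ⋙ φ) φ :=
  ObjectProperty.homMk
    { app := fun X => AddCommGrpCat.ofHom
        (φ.mapAddHom : (ψ.obj X.left.unop ⟶ X.right) →+ _)
      naturality := fun X Y t => by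
        have key : ∀ h : ψ.obj X.left.unop ⟶ X.right,
            φ.map (homBimodAct ψ (𝟭 R) X Y t h : ψ.obj Y.left.unop ⟶ Y.right) =
              homBimodAct (ψ ⋙ φ) φ X Y t (φ.map h) := by
          intro h
          induction t using TensorProduct.induction_on with
          | zero => exact φ.map_zero _ _
          | add s s' hs hs' =>
            rw [map_add, map_add]
            exact φ.map_add.trans (congrArg₂ (· + ·) hs hs')
          | tmul f g =>
            change φ.map (ψ.map f.unop ≫ h ≫ g) = φ.map (ψ.map f.unop) ≫ φ.map h ≫ φ.map g
            simp
        ext h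
        exact key h }

end Bimod

end HeavySep

end

/-! Both directions rest on one correspondence between `P` and `α`.

Given `α`, contraction `y ⊗ h ↦ N(α(h))(y)` maps `(φ^* N)(φ(ψ(a)))` to `N(ψ(a))`, and `P(g)` is the
composite of the unit `x ↦ x ⊗ 1`, of `g`, and of contraction. Naturality of `α` in `R` makes
contraction balanced; naturality in `Q` makes `P(g)` a morphism of `Q`-modules. Condition 1 gives
`α(1) = 1`, hence `P(φ^* p) = ψ_* p`. Condition 2 says that contraction does not distinguish pulling
back along `f` from pulling back along `φ(α(f))`; this yields `contract ∘ g = P(g) ∘ contract`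
(`contract_extendApp`), and multiplicativity of `P` follows.

Conversely, `φ^* R(-, b) ≅ S(-, φ(b))`, so `f : φ(ψ(a)) ⟶ φ(b)` is a morphism `f'` of extended
representables, and `α(f)` is `P(f')` evaluated at `1`. `P` is a priori only a transformation of
sets, but naturality forces it to be additive because right modules have biproducts (`homApp_add`).
The main identity is `α(g ∘ φ(x)) = P(g')(x)` (`evalYoneda_map_comp`); with `x = α(f)` and
multiplicativity of `P` it gives condition 2. -/

open CategoryTheory.Limits in
lemma CategoryTheory.Functor.biprod_additive {C : Type*} {D : Type*} [Category* C] [Category* D]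
    [Preadditive C] [Preadditive D] [HasBinaryBiproducts D] (F G : C ⥤ D) [F.Additive]
    [G.Additive] : (F ⊞ G).Additive where
  map_add {X Y f g} := by
    -- Written through projections and inclusions, the action on morphisms is visibly additive
    -- because composition is bilinear.
    have key : ∀ h : X ⟶ Y, (F ⊞ G).map h =
        (biprod.fst : F ⊞ G ⟶ F).app X ≫ F.map h ≫ (biprod.inl : F ⟶ F ⊞ G).app Y +
          (biprod.snd : F ⊞ G ⟶ G).app X ≫ G.map h ≫ (biprod.inr : G ⟶ F ⊞ G).app Y := by
      intro h
      rw [NatTrans.naturality, NatTrans.naturality, ← Category.assoc, ← Category.assoc,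
        ← Preadditive.add_comp, ← NatTrans.comp_app, ← NatTrans.comp_app, ← NatTrans.app_add,
        biprod.total, NatTrans.id_app, Category.id_comp]
    rw [key, key, key, F.map_add, G.map_add]
    simp only [Preadditive.add_comp, Preadditive.comp_add]
    abel

-- The biproduct of the underlying functors is again additive, so it serves in the full subcategory.
-- This supplies the biproducts of right modules that `homApp_add` requires.
open CategoryTheory.Limits in
instance CategoryTheory.AdditiveFunctor.hasBinaryBiproducts {C : Type*} {D : Type*} [Category* C]
    [Category* D] [Preadditive C] [Preadditive D] [HasBinaryBiproducts D] :
    HasBinaryBiproducts (C ⥤+ D) where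
  has_binary_biproduct F G :=
    have := Functor.biprod_additive F.obj G.obj
    hasBinaryBiproduct_of_total
      { pt := AdditiveFunctor.of (F.obj ⊞ G.obj)
        fst := ObjectProperty.homMk biprod.fst
        snd := ObjectProperty.homMk biprod.snd
        inl := ObjectProperty.homMk biprod.inl
        inr := ObjectProperty.homMk biprod.inr
        inl_fst := by ext : 1; exact biprod.inl_fst
        inl_snd := by ext : 1; exact biprod.inl_snd
        inr_fst := by ext : 1; exact biprod.inr_fst
        inr_snd := by ext : 1; exact biprod.inr_snd }
      (by ext : 1; exact biprod.total)

namespace HeavySep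

/-! ### Transformations between hom-functors, and their automatic additivity -/

section NatTrans

variable {C : Type u₁} [Category.{v₁} C] {D : Type u₂} [Category.{v} D]
    {X : Type u₃} [Category.{v} X] {F : C ⥤ D} {I : C ⥤ X}

/-- The component `D(F(a), F(b)) → X(I(a), I(b))` of a natural transformation
`D(F(-), F(-)) ⟶ X(I(-), I(-))`. -/
def homApp (P : F.op.prod F ⋙ Functor.hom D ⟶ I.op.prod I ⋙ Functor.hom X) {a b : C}
    (f : F.obj a ⟶ F.obj b) : I.obj a ⟶ I.obj b :=
  P.app (op a, b) f

variable (P : F.op.prod F ⋙ Functor.hom D ⟶ I.op.prod I ⋙ Functor.hom X)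

lemma homApp_naturality {a a' b b' : C} (p : a' ⟶ a) (f : F.obj a ⟶ F.obj b) (q : b ⟶ b') :
    homApp P (F.map p ≫ f ≫ F.map q) = I.map p ≫ homApp P f ≫ I.map q :=
  ConcreteCategory.congr_hom
    (P.naturality ((p.op, q) : ((op a, b) : Cᵒᵖ × C) ⟶ (op a', b'))) f

lemma homApp_map_comp {a a' b : C} (p : a' ⟶ a) (f : F.obj a ⟶ F.obj b) :
    homApp P (F.map p ≫ f) = I.map p ≫ homApp P f := by
  simpa using homApp_naturality P p f (𝟙 b)

lemma homApp_comp_map {a b b' : C} (f : F.obj a ⟶ F.obj b) (q : b ⟶ b') :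
    homApp P (f ≫ F.map q) = homApp P f ≫ I.map q := by
  simpa using homApp_naturality P (𝟙 a) f q

open Limits in
/-- A natural transformation `D(F(-), F(-)) ⟶ X(I(-), I(-))` of set-valued functors is additive as
soon as `F` and `I` are additive functors out of a category with binary biproducts. -/
lemma homApp_add [Preadditive C] [Preadditive D] [Preadditive X] [F.Additive] [I.Additive]
    [HasBinaryBiproducts C] {a b : C} (f g : F.obj a ⟶ F.obj b) :
    homApp P (f + g) = homApp P f + homApp P g := by
  -- `h` is the pair `(f, g)`; then `f`, `g` and `f + g` all arise from it by composing with the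
  -- image under `F` of a morphism of `C`, so naturality of `P` applies to each.
  let h : F.obj a ⟶ F.obj (b ⊞ b) := f ≫ F.map biprod.inl + g ≫ F.map biprod.inr
  have h₁ : h ≫ F.map biprod.fst = f := by
    simp [h, ← F.map_comp]
  have h₂ : h ≫ F.map biprod.snd = g := by
    simp [h, ← F.map_comp]
  calc homApp P (f + g) = homApp P (h ≫ F.map (biprod.fst + biprod.snd)) := by
        rw [F.map_add, Preadditive.comp_add, h₁, h₂]
    _ = homApp P h ≫ I.map biprod.fst + homApp P h ≫ I.map biprod.snd := by
        rw [homApp_comp_map, I.map_add, Preadditive.comp_add]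
    _ = homApp P f + homApp P g := by
        rw [← homApp_comp_map, ← homApp_comp_map, h₁, h₂]

/-- A natural transformation `D(F(-), F(-)) ⟶ X(I(-), I(-))` from its components. -/
def homTrans (P : ∀ {a b : C}, (F.obj a ⟶ F.obj b) → (I.obj a ⟶ I.obj b))
    (hP : ∀ {a a' b b' : C} (p : a' ⟶ a) (f : F.obj a ⟶ F.obj b) (q : b ⟶ b'),
      P (F.map p ≫ f ≫ F.map q) = I.map p ≫ P f ≫ I.map q) :
    F.op.prod F ⋙ Functor.hom D ⟶ I.op.prod I ⋙ Functor.hom X where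
  app x := TypeCat.ofHom fun f => (P (a := x.1.unop) (b := x.2) f)
  naturality x y t := by
    ext f
    exact hP t.1.unop f t.2

end NatTrans

/-! ### The universal property of `M ⊗_R N` -/

section Tensor

variable {R : Type u} [SmallCategory R] [Preadditive R]

open Classical in
/-- The additive map out of `M ⊗_R N` defined by a balanced family of biadditive maps. -/
noncomputable def tensorLift {M : RightMod R} {N : LeftMod R} {A : Type*} [AddCommGroup A]
    (β : ∀ a : R, M.obj.obj (op a) →+ N.obj.obj a →+ A)
    (hβ : ∀ {a b : R} (r : a ⟶ b) (x : M.obj.obj (op b)) (y : N.obj.obj a),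
      β a (M.obj.map r.op x) y = β b x (N.obj.map r y)) : Tensor M N →+ A :=
  QuotientAddGroup.lift (tensorRel M N)
    (DirectSum.toAddMonoid fun a => TensorProduct.liftAddHom (β a)
      (fun n x y => by rw [map_zsmul, map_zsmul]; rfl)) (by
    rw [tensorRel, AddSubgroup.closure_le]
    rintro _ ⟨a, b, r, x, y, rfl⟩
    rw [SetLike.mem_coe, AddMonoidHom.mem_ker, map_sub, preTmul, preTmul,
      DirectSum.toAddMonoid_of, DirectSum.toAddMonoid_of, sub_eq_zero]
    exact hβ r x y)

@[simp]
lemma tensorLift_tmul {M : RightMod R} {N : LeftMod R} {A : Type*} [AddCommGroup A]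
    (β : ∀ a : R, M.obj.obj (op a) →+ N.obj.obj a →+ A)
    (hβ : ∀ {a b : R} (r : a ⟶ b) (x : M.obj.obj (op b)) (y : N.obj.obj a),
      β a (M.obj.map r.op x) y = β b x (N.obj.map r y)) (a : R) (x : M.obj.obj (op a))
    (y : N.obj.obj a) : tensorLift β hβ (tmul M N a x y) = β a x y := by
  classical
  simp only [tensorLift, tmul, preTmul]
  erw [QuotientAddGroup.lift_mk]
  convert DirectSum.toAddMonoid_of _ _ _
  rfl

lemma tmul_add_left {M : RightMod R} {N : LeftMod R} (a : R) (x x' : M.obj.obj (op a))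
    (y : N.obj.obj a) : tmul M N a (x + x') y = tmul M N a x y + tmul M N a x' y := by
  simp only [tmul, preTmul, TensorProduct.add_tmul, map_add]

lemma tensorMap_add_left {M M' : RightMod R} {N N' : LeftMod R} (p p' : M ⟶ M') (q : N ⟶ N') :
    tensorMap (p + p') q = tensorMap p q + tensorMap p' q :=
  tensor_hom_ext fun a x y => by
    rw [AddMonoidHom.add_apply, tensorMap_tmul, tensorMap_tmul, tensorMap_tmul,
      ← tmul_add_left]
    rfl

end Tensor

/-! ### Bimodule morphisms in terms of their components -/

section Bimod

variable {Q R S S' : Type u} [SmallCategory Q] [Preadditive Q] [SmallCategory R] [Preadditive R]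
  [SmallCategory S] [Preadditive S] [SmallCategory S'] [Preadditive S']
  {F : Q ⥤ S} {G : R ⥤ S} {F' : Q ⥤ S'} {G' : R ⥤ S'} [F.Additive] [G.Additive] [F'.Additive]
  [G'.Additive]

lemma bimodApp_add (α : homBimod F G ⟶ homBimod F' G') {a : Q} {b : R}
    (h h' : F.obj a ⟶ G.obj b) :
    bimodApp α a b (h + h') = bimodApp α a b h + bimodApp α a b h' :=
  (α.hom.app ⟨op a, b⟩).hom.map_add h h'

lemma bimodApp_naturality (α : homBimod F G ⟶ homBimod F' G') {a a' : Q} {b b' : R}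
    (f : a' ⟶ a) (h : F.obj a ⟶ G.obj b) (g : b ⟶ b') :
    bimodApp α a' b' (F.map f ≫ h ≫ G.map g) = F'.map f ≫ bimodApp α a b h ≫ G'.map g := by
  -- A pure tensor is the morphism of `Qᵒᵖ ⊗ R` that encodes acting on both sides at once.
  let t : (⟨op a, b⟩ : TensorCat Qᵒᵖ R) ⟶ ⟨op a', b'⟩ :=
    ((f.op ⊗ₜ[ℤ] g : (op a ⟶ op a') ⊗[ℤ] (b ⟶ b')))
  exact ConcreteCategory.congr_hom (α.hom.naturality t) h

lemma bimodApp_map_comp (α : homBimod F G ⟶ homBimod F' G') {a a' : Q} {b : R}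
    (f : a' ⟶ a) (h : F.obj a ⟶ G.obj b) :
    bimodApp α a' b (F.map f ≫ h) = F'.map f ≫ bimodApp α a b h := by
  simpa using bimodApp_naturality α f h (𝟙 b)

lemma bimodApp_comp_map (α : homBimod F G ⟶ homBimod F' G') {a : Q} {b b' : R}
    (h : F.obj a ⟶ G.obj b) (g : b ⟶ b') :
    bimodApp α a b' (h ≫ G.map g) = bimodApp α a b h ≫ G'.map g := by
  simpa using bimodApp_naturality α (𝟙 a) h g

/-- A morphism of bimodules of the form `S(F(-), G(-))` from its components. -/
def bimodMk (α : ∀ (a : Q) (b : R), (F.obj a ⟶ G.obj b) →+ (F'.obj a ⟶ G'.obj b))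
    (hα : ∀ {a a' : Q} {b b' : R} (f : a' ⟶ a) (h : F.obj a ⟶ G.obj b) (g : b ⟶ b'),
      α a' b' (F.map f ≫ h ≫ G.map g) = F'.map f ≫ α a b h ≫ G'.map g) :
    homBimod F G ⟶ homBimod F' G' :=
  ObjectProperty.homMk
    { app := fun X => AddCommGrpCat.ofHom (α X.left.unop X.right)
      naturality := fun X Y t => by
        have key : ∀ h : F.obj X.left.unop ⟶ G.obj X.right,
            α Y.left.unop Y.right (homBimodAct F G X Y t h) =
              homBimodAct F' G' X Y t (α X.left.unop X.right h) := by
          intro h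
          induction t using TensorProduct.induction_on with
          | zero => simp
          | add s s' hs hs' =>
            rw [map_add, map_add, LinearMap.add_apply, LinearMap.add_apply, map_add, hs, hs']
          | tmul f g => exact hα f.unop h g
        ext h
        exact key h }

end Bimod

/-! ### Extended and restricted modules, and the two directions of the equivalence -/

section Scalars

variable {Q R S : Type u} [SmallCategory Q] [Preadditive Q] [SmallCategory R] [Preadditive R]
  [SmallCategory S] [Preadditive S] (φ : R ⥤ S) [φ.Additive] (ψ : Q ⥤ R) [ψ.Additive]

instance : (restrictScalars φ).Additive where
  map_add := rfl

instance : (extendScalars φ).Additive where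
  map_add {M N p q} := by
    ext s : 3
    exact congrArg AddCommGrpCat.ofHom (tensorMap_add_left p q (𝟙 (homLeft φ s.unop)))

/-! #### Elements and morphisms of extended and restricted modules -/

/-- The element `y ⊗ h` of `M ⊗_R S(s, φ(-))`. -/
noncomputable def extendTmul (M : RightMod R) {s : S} {b : R} (y : M.obj.obj (op b))
    (h : s ⟶ φ.obj b) : Tensor M (homLeft φ s) :=
  tmul M (homLeft φ s) b y h

/-- The map `M ⊗_R S(s, φ(-)) → M ⊗_R S(t, φ(-))` induced by `k : t ⟶ s`. -/
noncomputable def extendPrecomp (M : RightMod R) {s t : S} (k : t ⟶ s) :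
    Tensor M (homLeft φ s) →+ Tensor M (homLeft φ t) :=
  tensorMap (𝟙 M) (homLeftMap φ k)

variable {φ}

lemma extend_hom_ext {M : RightMod R} {s : S} {A : Type*} [AddCommGroup A]
    {p q : Tensor M (homLeft φ s) →+ A}
    (h : ∀ (b : R) (y : M.obj.obj (op b)) (k : s ⟶ φ.obj b),
      p (extendTmul φ M y k) = q (extendTmul φ M y k)) : p = q :=
  tensor_hom_ext h

lemma extendTmul_add_left (M : RightMod R) {s : S} {b : R} (y y' : M.obj.obj (op b))
    (h : s ⟶ φ.obj b) :
    extendTmul φ M (y + y') h = extendTmul φ M y h + extendTmul φ M y' h :=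
  tmul_add_left _ _ _ _

lemma extendTmul_add_right (M : RightMod R) {s : S} {b : R} (y : M.obj.obj (op b))
    (h h' : s ⟶ φ.obj b) :
    extendTmul φ M y (h + h') = extendTmul φ M y h + extendTmul φ M y h' :=
  tmul_add_right _ _ _ _

lemma extendTmul_map (M : RightMod R) {s : S} {b c : R} (r : b ⟶ c) (y : M.obj.obj (op c))
    (h : s ⟶ φ.obj b) :
    extendTmul φ M (M.obj.map r.op y) h = extendTmul φ M y (h ≫ φ.map r) :=
  tmul_balanced (N := homLeft φ s) r y h

@[simp]
lemma extendPrecomp_tmul (M : RightMod R) {s t : S} {b : R} (k : t ⟶ s) (y : M.obj.obj (op b))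
    (h : s ⟶ φ.obj b) :
    extendPrecomp φ M k (extendTmul φ M y h) = extendTmul φ M y (k ≫ h) :=
  tensorMap_tmul (𝟙 M) (homLeftMap φ k) b y h

/-- The additive map out of `M ⊗_R S(s, φ(-))` defined by a balanced family of biadditive maps. -/
noncomputable def extendLift {M : RightMod R} {s : S} {A : Type*} [AddCommGroup A]
    (β : ∀ b : R, M.obj.obj (op b) →+ (s ⟶ φ.obj b) →+ A)
    (hβ : ∀ (b c : R) (r : b ⟶ c) (y : M.obj.obj (op c)) (h : s ⟶ φ.obj b),
      β b (M.obj.map r.op y) h = β c y (h ≫ φ.map r)) : Tensor M (homLeft φ s) →+ A :=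
  tensorLift β (fun {_ _} => hβ _ _)

@[simp]
lemma extendLift_tmul {M : RightMod R} {s : S} {A : Type*} [AddCommGroup A]
    (β : ∀ b : R, M.obj.obj (op b) →+ (s ⟶ φ.obj b) →+ A)
    (hβ : ∀ (b c : R) (r : b ⟶ c) (y : M.obj.obj (op c)) (h : s ⟶ φ.obj b),
      β b (M.obj.map r.op y) h = β c y (h ≫ φ.map r)) {b : R} (y : M.obj.obj (op b))
    (h : s ⟶ φ.obj b) : extendLift β hβ (extendTmul φ M y h) = β b y h :=
  tensorLift_tmul (N := homLeft φ s) β (fun {_ _} => hβ _ _) b y h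

/-- The component at `s` of a morphism `φ^* M ⟶ φ^* N`. -/
def extendApp {M N : RightMod R} (g : (extendScalars φ).obj M ⟶ (extendScalars φ).obj N) (s : S) :
    Tensor M (homLeft φ s) →+ Tensor N (homLeft φ s) :=
  (g.hom.app (op s)).hom

section ExtendApp

variable {L M N : RightMod R}

lemma extendApp_precomp (g : (extendScalars φ).obj M ⟶ (extendScalars φ).obj N) {s t : S}
    (k : t ⟶ s) (z : Tensor M (homLeft φ s)) :
    extendApp g t (extendPrecomp φ M k z) = extendPrecomp φ N k (extendApp g s z) :=
  ConcreteCategory.congr_hom (g.hom.naturality k.op) z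

lemma extendApp_comp (f : (extendScalars φ).obj L ⟶ (extendScalars φ).obj M)
    (g : (extendScalars φ).obj M ⟶ (extendScalars φ).obj N) (s : S)
    (z : Tensor L (homLeft φ s)) :
    extendApp (f ≫ g) s z = extendApp g s (extendApp f s z) := rfl

lemma extendApp_add (f g : (extendScalars φ).obj M ⟶ (extendScalars φ).obj N) (s : S)
    (z : Tensor M (homLeft φ s)) :
    extendApp (f + g) s z = extendApp f s z + extendApp g s z := rfl

@[simp]
lemma extendApp_map_tmul (p : M ⟶ N) {s : S} {b : R} (y : M.obj.obj (op b)) (h : s ⟶ φ.obj b) :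
    extendApp ((extendScalars φ).map p) s (extendTmul φ M y h) =
      extendTmul φ N (p.hom.app (op b) y) h :=
  tensorMap_tmul p (𝟙 (homLeft φ s)) b y h

lemma extendApp_ext {f g : (extendScalars φ).obj M ⟶ (extendScalars φ).obj N}
    (h : ∀ s z, extendApp f s z = extendApp g s z) : f = g := by
  ext s : 3
  exact AddCommGrpCat.hom_ext (AddMonoidHom.ext fun z => h s.unop z)

/-- A morphism `φ^* M ⟶ φ^* N` from its components. -/
def extendHomMk (p : ∀ s : S, Tensor M (homLeft φ s) →+ Tensor N (homLeft φ s))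
    (hp : ∀ {s t : S} (k : t ⟶ s) (z : Tensor M (homLeft φ s)),
      p t (extendPrecomp φ M k z) = extendPrecomp φ N k (p s z)) :
    (extendScalars φ).obj M ⟶ (extendScalars φ).obj N :=
  ObjectProperty.homMk
    { app := fun s => AddCommGrpCat.ofHom (p s.unop)
      naturality := fun _ _ k => AddCommGrpCat.hom_ext (AddMonoidHom.ext fun z => hp k.unop z) }

end ExtendApp

variable {ψ}

/-- The component at `a` of a morphism `ψ_* M ⟶ ψ_* N`. -/
def restrictApp {M N : RightMod R} (g : (restrictScalars ψ).obj M ⟶ (restrictScalars ψ).obj N)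
    (a : Q) : M.obj.obj (op (ψ.obj a)) →+ N.obj.obj (op (ψ.obj a)) :=
  (g.hom.app (op a)).hom

section RestrictApp

variable {L M N : RightMod R}

lemma restrictApp_map (p : M ⟶ N) (a : Q) (x : M.obj.obj (op (ψ.obj a))) :
    restrictApp ((restrictScalars ψ).map p) a x = p.hom.app (op (ψ.obj a)) x := rfl

lemma restrictApp_comp (f : (restrictScalars ψ).obj L ⟶ (restrictScalars ψ).obj M)
    (g : (restrictScalars ψ).obj M ⟶ (restrictScalars ψ).obj N) (a : Q)
    (x : L.obj.obj (op (ψ.obj a))) :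
    restrictApp (f ≫ g) a x = restrictApp g a (restrictApp f a x) := rfl

lemma restrictApp_ext {f g : (restrictScalars ψ).obj M ⟶ (restrictScalars ψ).obj N}
    (h : ∀ a x, restrictApp f a x = restrictApp g a x) : f = g := by
  ext a : 3
  exact AddCommGrpCat.hom_ext (AddMonoidHom.ext fun x => h a.unop x)

/-- A morphism `ψ_* M ⟶ ψ_* N` from its components. -/
def restrictHomMk (p : ∀ a : Q, M.obj.obj (op (ψ.obj a)) →+ N.obj.obj (op (ψ.obj a)))
    (hp : ∀ {a a' : Q} (u : a' ⟶ a) (x : M.obj.obj (op (ψ.obj a))),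
      p a' (M.obj.map (ψ.map u).op x) = N.obj.map (ψ.map u).op (p a x)) :
    (restrictScalars ψ).obj M ⟶ (restrictScalars ψ).obj N :=
  ObjectProperty.homMk
    { app := fun a => AddCommGrpCat.ofHom (p a.unop)
      naturality := fun _ _ u => AddCommGrpCat.hom_ext (AddMonoidHom.ext fun x => hp u.unop x) }

end RestrictApp

/-! #### Representable modules -/

variable (R) in
/-- The Yoneda embedding `R ⥤ M_R`, `b ↦ R(-, b)`. -/
def yonedaMod : R ⥤ RightMod R where
  obj b := AdditiveFunctor.of (preadditiveYoneda.obj b)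
  map g := ObjectProperty.homMk (preadditiveYoneda.map g)

/-- The map `R(-, b) ⊗_R S(s, φ(-)) → S(s, φ(b))`, `x ⊗ h ↦ φ(x) ∘ h`. -/
noncomputable def yonedaEval (b : R) (s : S) :
    Tensor ((yonedaMod R).obj b) (homLeft φ s) →+ (s ⟶ φ.obj b) :=
  extendLift (M := (yonedaMod R).obj b)
    (fun c => AddMonoidHom.mk' (fun x : c ⟶ b => Preadditive.rightComp s (φ.map x))
      (fun (x x' : c ⟶ b) => AddMonoidHom.ext fun h =>
        (congrArg (h ≫ ·) (φ.map_add (f := x) (g := x'))).trans (Preadditive.comp_add ..)))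
    (fun c d r (x : d ⟶ b) h => by
      change h ≫ φ.map (r ≫ x) = (h ≫ φ.map r) ≫ φ.map x
      rw [φ.map_comp, Category.assoc])

/-- The element `x ⊗ h` of `R(-, b) ⊗_R S(s, φ(-))`. -/
noncomputable def yonedaTmul {b c : R} {s : S} (x : c ⟶ b) (h : s ⟶ φ.obj c) :
    Tensor ((yonedaMod R).obj b) (homLeft φ s) :=
  extendTmul φ ((yonedaMod R).obj b) x h

@[simp]
lemma yonedaEval_tmul {b c : R} {s : S} (x : c ⟶ b) (h : s ⟶ φ.obj c) :
    yonedaEval b s (yonedaTmul x h) = h ≫ φ.map x :=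
  extendLift_tmul (M := (yonedaMod R).obj b) _ _ _ _

lemma yonedaTmul_comp {b c d : R} {s : S} (r : c ⟶ d) (x : d ⟶ b) (h : s ⟶ φ.obj c) :
    yonedaTmul (r ≫ x) h = yonedaTmul x (h ≫ φ.map r) :=
  extendTmul_map ((yonedaMod R).obj b) r x h

lemma yoneda_hom_ext {b : R} {s : S} {A : Type*} [AddCommGroup A]
    {p q : Tensor ((yonedaMod R).obj b) (homLeft φ s) →+ A}
    (h : ∀ (c : R) (x : c ⟶ b) (k : s ⟶ φ.obj c),
      p (yonedaTmul x k) = q (yonedaTmul x k)) : p = q :=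
  extend_hom_ext h

lemma yonedaTmul_add {b c : R} {s : S} (x : c ⟶ b) (h h' : s ⟶ φ.obj c) :
    yonedaTmul x (h + h') = yonedaTmul x h + yonedaTmul x h' :=
  extendTmul_add_right ((yonedaMod R).obj b) x h h'

/-- Balancing gives `x ⊗ h = 1 ⊗ (φ(x) ∘ h)`, so the sections `h ↦ 1 ⊗ h` already reach every
tensor. -/
lemma yonedaTmul_yonedaEval {b : R} {s : S} (z : Tensor ((yonedaMod R).obj b) (homLeft φ s)) :
    yonedaTmul (𝟙 b) (yonedaEval b s z) = z := by
  let p : (s ⟶ φ.obj b) →+ Tensor ((yonedaMod R).obj b) (homLeft φ s) :=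
    AddMonoidHom.mk' (fun h => yonedaTmul (𝟙 b) h) (yonedaTmul_add (𝟙 b))
  have hp : p.comp (yonedaEval b s) = AddMonoidHom.id _ := yoneda_hom_ext fun c x k => by
    change yonedaTmul (𝟙 b) (yonedaEval b s (yonedaTmul x k)) = yonedaTmul x k
    rw [yonedaEval_tmul, ← yonedaTmul_comp, Category.comp_id]
  exact DFunLike.congr_fun hp z

/-- The isomorphism `S(s, φ(b)) ≅ R(-, b) ⊗_R S(s, φ(-))`, `h ↦ 1 ⊗ h`. -/
noncomputable def yonedaExtendEquiv (b : R) (s : S) :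
    (s ⟶ φ.obj b) ≃+ Tensor ((yonedaMod R).obj b) (homLeft φ s) where
  toFun h := yonedaTmul (𝟙 b) h
  invFun := yonedaEval b s
  left_inv h := by rw [yonedaEval_tmul, φ.map_id, Category.comp_id]
  right_inv := yonedaTmul_yonedaEval
  map_add' := yonedaTmul_add (𝟙 b)

lemma yonedaExtendEquiv_symm_precomp {b : R} {s t : S} (k : t ⟶ s)
    (z : Tensor ((yonedaMod R).obj b) (homLeft φ s)) :
    (yonedaExtendEquiv b t).symm (extendPrecomp φ _ k z) =
      k ≫ (yonedaExtendEquiv b s).symm z := by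
  refine DFunLike.congr_fun (yoneda_hom_ext
    (p := (yonedaEval b t).comp (extendPrecomp φ _ k))
    (q := (Preadditive.leftComp (φ.obj b) k).comp (yonedaEval b s)) fun c x h => ?_) z
  rw [AddMonoidHom.comp_apply, AddMonoidHom.comp_apply, yonedaEval_tmul]
  refine (congrArg (yonedaEval b t) (extendPrecomp_tmul _ k _ h)).trans ?_
  exact (yonedaEval_tmul x (k ≫ h)).trans (Category.assoc _ _ _)

lemma yonedaExtendEquiv_symm_map {b c : R} (u : b ⟶ c) {s : S}
    (z : Tensor ((yonedaMod R).obj b) (homLeft φ s)) :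
    (yonedaExtendEquiv c s).symm (extendApp ((extendScalars φ).map ((yonedaMod R).map u)) s z) =
      (yonedaExtendEquiv b s).symm z ≫ φ.map u := by
  refine DFunLike.congr_fun (yoneda_hom_ext
    (p := (yonedaEval c s).comp (extendApp ((extendScalars φ).map ((yonedaMod R).map u)) s))
    (q := (Preadditive.rightComp s (φ.map u)).comp (yonedaEval b s)) fun d x h => ?_) z
  rw [AddMonoidHom.comp_apply, AddMonoidHom.comp_apply, yonedaEval_tmul]
  refine (congrArg (yonedaEval c s) (extendApp_map_tmul _ _ h)).trans ?_
  refine (yonedaEval_tmul (x ≫ u) h).trans ?_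
  rw [φ.map_comp, ← Category.assoc]
  rfl

/-- The morphism `R(-, r) ⊗_R S(-, φ(-)) ⟶ R(-, b) ⊗_R S(-, φ(-))` that corresponds to a morphism
`f : φ(r) ⟶ φ(b)` under the isomorphisms `yonedaExtendEquiv`. -/
noncomputable def extendYoneda {r b : R} (f : φ.obj r ⟶ φ.obj b) :
    (extendScalars φ).obj ((yonedaMod R).obj r) ⟶ (extendScalars φ).obj ((yonedaMod R).obj b) :=
  extendHomMk (fun s => (yonedaExtendEquiv b s).toAddMonoidHom.comp
      ((Preadditive.rightComp s f).comp (yonedaExtendEquiv r s).symm.toAddMonoidHom))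
    -- Read in `S(t, φ(b))`, the naturality square is associativity: precomposition with `k`
    -- commutes with postcomposition with `f`.
    (fun {s t} k z => (yonedaExtendEquiv b t).symm.injective (by
      refine ((yonedaExtendEquiv b t).symm_apply_apply _).trans ?_
      rw [yonedaExtendEquiv_symm_precomp]
      refine Eq.trans ?_ (congrArg (k ≫ ·) ((yonedaExtendEquiv b s).symm_apply_apply _).symm)
      refine (congrArg (· ≫ f) (yonedaExtendEquiv_symm_precomp k z)).trans ?_
      exact Category.assoc _ _ _))

lemma yonedaExtendEquiv_symm_extendYoneda {r b : R} (f : φ.obj r ⟶ φ.obj b) {s : S}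
    (z : Tensor ((yonedaMod R).obj r) (homLeft φ s)) :
    (yonedaExtendEquiv b s).symm (extendApp (extendYoneda f) s z) =
      (yonedaExtendEquiv r s).symm z ≫ f :=
  (yonedaExtendEquiv b s).symm_apply_apply _

/-- Both sides become postcomposition with `φ(u)` under the isomorphisms. This is what lets the
naturality and normalization of `P` apply to morphisms coming from `R`. -/
lemma extendYoneda_map {r b : R} (u : r ⟶ b) :
    extendYoneda (φ.map u) = (extendScalars φ).map ((yonedaMod R).map u) :=
  extendApp_ext fun s z => (yonedaExtendEquiv b s).symm.injective (by
    rw [yonedaExtendEquiv_symm_extendYoneda, yonedaExtendEquiv_symm_map])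

lemma extendYoneda_comp {r b c : R} (f : φ.obj r ⟶ φ.obj b) (g : φ.obj b ⟶ φ.obj c) :
    extendYoneda (f ≫ g) = extendYoneda f ≫ extendYoneda g :=
  extendApp_ext fun s z => (yonedaExtendEquiv c s).symm.injective (by
    rw [extendApp_comp, yonedaExtendEquiv_symm_extendYoneda, yonedaExtendEquiv_symm_extendYoneda,
      yonedaExtendEquiv_symm_extendYoneda, Category.assoc])

lemma extendYoneda_add {r b : R} (f g : φ.obj r ⟶ φ.obj b) :
    extendYoneda (f + g) = extendYoneda f + extendYoneda g :=
  extendApp_ext fun s z => (yonedaExtendEquiv b s).symm.injective (by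
    rw [extendApp_add, map_add, yonedaExtendEquiv_symm_extendYoneda,
      yonedaExtendEquiv_symm_extendYoneda, yonedaExtendEquiv_symm_extendYoneda,
      Preadditive.comp_add])

/-- The component `R(ψ(a), r) → R(ψ(a), b)` of a morphism `ψ_* R(-, r) ⟶ ψ_* R(-, b)`. -/
def restrictYonedaApp {r b : R}
    (p : (restrictScalars ψ).obj ((yonedaMod R).obj r) ⟶
      (restrictScalars ψ).obj ((yonedaMod R).obj b)) (a : Q) : (ψ.obj a ⟶ r) →+ (ψ.obj a ⟶ b) :=
  restrictApp p a

section RestrictYonedaApp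

variable {r b c : R} (p : (restrictScalars ψ).obj ((yonedaMod R).obj r) ⟶
      (restrictScalars ψ).obj ((yonedaMod R).obj b))

lemma restrictYonedaApp_naturality {a a' : Q} (u : a' ⟶ a) (x : ψ.obj a ⟶ r) :
    restrictYonedaApp p a' (ψ.map u ≫ x) = ψ.map u ≫ restrictYonedaApp p a x :=
  ConcreteCategory.congr_hom (p.hom.naturality u.op) x

lemma restrictYonedaApp_comp (q : (restrictScalars ψ).obj ((yonedaMod R).obj b) ⟶
      (restrictScalars ψ).obj ((yonedaMod R).obj c)) (a : Q) (x : ψ.obj a ⟶ r) :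
    restrictYonedaApp (p ≫ q) a x = restrictYonedaApp q a (restrictYonedaApp p a x) := rfl

lemma restrictYonedaApp_map (u : r ⟶ b) (a : Q) (x : ψ.obj a ⟶ r) :
    restrictYonedaApp ((restrictScalars ψ).map ((yonedaMod R).map u)) a x = x ≫ u := rfl

end RestrictYonedaApp

/-! #### From bimodule morphisms to heavy separability -/

/-- The map `N ⊗_R S(φ(ψ(a)), φ(-)) → N(ψ(a))`, `y ⊗ h ↦ N(α(h))(y)`. -/
noncomputable def contract (α : homBimod (ψ ⋙ φ) φ ⟶ homBimod ψ (𝟭 R)) (N : RightMod R) (a : Q) :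
    Tensor N (homLeft φ (φ.obj (ψ.obj a))) →+ N.obj.obj (op (ψ.obj a)) :=
  extendLift
    (fun b => AddMonoidHom.mk' (fun y => AddMonoidHom.mk'
      (fun h : φ.obj (ψ.obj a) ⟶ φ.obj b => N.obj.map (bimodApp α a b h).op y)
      (fun h h' => (congrArg (fun k => N.obj.map (Quiver.Hom.op k) y) (bimodApp_add α h h')).trans
        (ConcreteCategory.congr_hom (N.obj.map_add
          (f := (bimodApp α a b h).op) (g := (bimodApp α a b h').op)) y)))
      (fun y y' => AddMonoidHom.ext fun h =>
        map_add (N.obj.map (bimodApp α a b h).op).hom y y'))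
    (fun b c r y h => by
      -- Balancedness is naturality of `α` in the `R`-variable; the type ascription replaces `(𝟭
      -- R).map r` by `r`.
      refine Eq.trans ?_ (congrArg (fun k => N.obj.map (Quiver.Hom.op k) y)
        (bimodApp_comp_map α h r : _ = bimodApp α a b h ≫ r)).symm
      rw [op_comp, N.obj.map_comp]
      rfl)

variable (α : homBimod (ψ ⋙ φ) φ ⟶ homBimod ψ (𝟭 R))

@[simp]
lemma contract_tmul (N : RightMod R) (a : Q) (b : R)
    (y : N.obj.obj (op b)) (h : φ.obj (ψ.obj a) ⟶ φ.obj b) :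
    contract α N a (extendTmul φ N y h) = N.obj.map (bimodApp α a b h).op y :=
  extendLift_tmul _ _ _ _

lemma contract_map {N N' : RightMod R} (q : N ⟶ N') (a : Q)
    (z : Tensor N (homLeft φ (φ.obj (ψ.obj a)))) :
    contract α N' a (extendApp ((extendScalars φ).map q) _ z) =
      q.hom.app (op (ψ.obj a)) (contract α N a z) := by
  refine DFunLike.congr_fun (extend_hom_ext
    (p := (contract α N' a).comp (extendApp ((extendScalars φ).map q) _))
    (q := (q.hom.app (op (ψ.obj a))).hom.comp (contract α N a)) fun b y h => ?_) z
  rw [AddMonoidHom.comp_apply, AddMonoidHom.comp_apply, extendApp_map_tmul, contract_tmul,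
    contract_tmul]
  exact (ConcreteCategory.congr_hom (q.hom.naturality (bimodApp α a b h).op) y).symm

/-- Naturality of `α` in the `Q`-variable, seen on pure tensors; it makes `contractHom` a morphism
of `Q`-modules. -/
lemma contract_precomp (N : RightMod R) {a a' : Q} (u : a' ⟶ a)
    (z : Tensor N (homLeft φ (φ.obj (ψ.obj a)))) :
    contract α N a' (extendPrecomp φ N (φ.map (ψ.map u)) z) =
      N.obj.map (ψ.map u).op (contract α N a z) := by
  refine DFunLike.congr_fun (extend_hom_ext
    (p := (contract α N a').comp (extendPrecomp φ N (φ.map (ψ.map u))))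
    (q := (N.obj.map (ψ.map u).op).hom.comp (contract α N a)) fun b y h => ?_) z
  rw [AddMonoidHom.comp_apply, AddMonoidHom.comp_apply, extendPrecomp_tmul, contract_tmul,
    contract_tmul]
  refine (congrArg (fun k => N.obj.map (Quiver.Hom.op k) y)
    (bimodApp_map_comp α u h : _ = ψ.map u ≫ bimodApp α a b h)).trans ?_
  rw [op_comp, N.obj.map_comp]
  rfl

variable (φ) in
/-- The unit `M(r) → M ⊗_R S(φ(r), φ(-))`, `x ↦ x ⊗ 1`, of the adjunction between extension
and restriction of scalars. -/
noncomputable def extendUnit (M : RightMod R) (r : R) :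
    M.obj.obj (op r) →+ Tensor M (homLeft φ (φ.obj r)) :=
  AddMonoidHom.mk' (fun x => extendTmul φ M x (𝟙 (φ.obj r)))
    (fun x y => extendTmul_add_left M x y _)

lemma extendUnit_apply (M : RightMod R) (r : R) (x : M.obj.obj (op r)) :
    extendUnit φ M r x = extendTmul φ M x (𝟙 (φ.obj r)) := rfl

lemma extendUnit_map (M : RightMod R) {r r' : R} (u : r' ⟶ r) (x : M.obj.obj (op r)) :
    extendUnit φ M r' (M.obj.map u.op x) = extendPrecomp φ M (φ.map u) (extendUnit φ M r x) := by
  rw [extendUnit_apply, extendUnit_apply, extendTmul_map, extendPrecomp_tmul, Category.id_comp,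
    Category.comp_id]

/-- The elements `y ⊗ 1` generate the extended module over `S`, so a morphism out of it is
controlled by its values on the unit. -/
lemma extendTmul_eq_precomp (M : RightMod R) {s : S} {b : R} (y : M.obj.obj (op b))
    (h : s ⟶ φ.obj b) :
    extendTmul φ M y h = extendPrecomp φ M h (extendUnit φ M b y) := by
  rw [extendUnit_apply, extendPrecomp_tmul, Category.comp_id]

/-- The morphism `ψ_* M ⟶ ψ_* N` that sends `x ∈ M(ψ(a))` to the contraction of `g(x ⊗ 1)`. -/
noncomputable def contractHom {M N : RightMod R}
    (g : (extendScalars φ).obj M ⟶ (extendScalars φ).obj N) :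
    (restrictScalars ψ).obj M ⟶ (restrictScalars ψ).obj N :=
  restrictHomMk (fun a => (contract α N a).comp
      ((extendApp g (φ.obj (ψ.obj a))).comp (extendUnit φ M (ψ.obj a))))
    (fun u x => by
      simp only [AddMonoidHom.comp_apply]
      rw [extendUnit_map, extendApp_precomp, contract_precomp])

lemma contractHom_app {M N : RightMod R}
    (g : (extendScalars φ).obj M ⟶ (extendScalars φ).obj N) (a : Q)
    (x : M.obj.obj (op (ψ.obj a))) :
    restrictApp (contractHom α g) a x =
      contract α N a (extendApp g (φ.obj (ψ.obj a)) (extendUnit φ M (ψ.obj a) x)) := rfl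

lemma contractHom_naturality {M M' N N' : RightMod R} (p : M' ⟶ M)
    (g : (extendScalars φ).obj M ⟶ (extendScalars φ).obj N) (q : N ⟶ N') :
    contractHom α ((extendScalars φ).map p ≫ g ≫ (extendScalars φ).map q) =
      (restrictScalars ψ).map p ≫ contractHom α g ≫ (restrictScalars ψ).map q := by
  refine restrictApp_ext fun a x => ?_
  rw [restrictApp_comp, restrictApp_comp, restrictApp_map, restrictApp_map, contractHom_app,
    contractHom_app, extendApp_comp, extendApp_comp, contract_map, extendUnit_apply,
    extendApp_map_tmul, extendUnit_apply]

lemma bimodApp_of_mapBimod_comp (h : mapBimod ψ φ ≫ α = 𝟙 _) {a : Q} {b : R}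
    (f : ψ.obj a ⟶ b) : bimodApp α a b (φ.map f) = f :=
  congrArg (fun p : homBimod ψ (𝟭 R) ⟶ homBimod ψ (𝟭 R) => bimodApp p a b f) h

/-- Contraction commutes with `p`, and contracting `x ⊗ 1` returns `x`, since `α(φ(1)) = 1`. -/
lemma contractHom_map (h : mapBimod ψ φ ≫ α = 𝟙 _) {M N : RightMod R} (p : M ⟶ N) :
    contractHom α ((extendScalars φ).map p) = (restrictScalars ψ).map p := by
  refine restrictApp_ext fun a x => ?_
  rw [contractHom_app, contract_map, restrictApp_map, extendUnit_apply, contract_tmul,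
    ← φ.map_id]
  refine congrArg (p.hom.app (op (ψ.obj a))) ((congrArg (fun k => M.obj.map (Quiver.Hom.op k) x)
    (bimodApp_of_mapBimod_comp α h (𝟙 (ψ.obj a)))).trans ?_)
  simp

/-- If `α(g ∘ f) = α(g ∘ φ(α(f)))`, then contracting `g(z)` amounts to contracting `z` first. -/
lemma contract_extendApp
    (h : ∀ (a : Q) (b c : R) (f : φ.obj (ψ.obj a) ⟶ φ.obj b) (g : φ.obj b ⟶ φ.obj c),
      bimodApp α a c (f ≫ g) = bimodApp α a c (φ.map (bimodApp α a b f) ≫ g))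
    {M N : RightMod R} (g : (extendScalars φ).obj M ⟶ (extendScalars φ).obj N) (a : Q)
    (z : Tensor M (homLeft φ (φ.obj (ψ.obj a)))) :
    contract α N a (extendApp g (φ.obj (ψ.obj a)) z) =
      restrictApp (contractHom α g) a (contract α M a z) := by
  refine DFunLike.congr_fun (extend_hom_ext
    (p := (contract α N a).comp (extendApp g (φ.obj (ψ.obj a))))
    (q := (restrictApp (contractHom α g) a).comp (contract α M a)) fun b y f => ?_) z
  -- Condition 2 in module form: after contraction, `f` may be replaced by `φ(α(f))`.
  have key : ∀ w : Tensor N (homLeft φ (φ.obj b)),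
      contract α N a (extendPrecomp φ N f w) =
        contract α N a (extendPrecomp φ N (φ.map (bimodApp α a b f)) w) := by
    refine DFunLike.congr_fun (extend_hom_ext
      (p := (contract α N a).comp (extendPrecomp φ N f))
      (q := (contract α N a).comp (extendPrecomp φ N (φ.map (bimodApp α a b f))))
      fun c y k => ?_)
    rw [AddMonoidHom.comp_apply, AddMonoidHom.comp_apply, extendPrecomp_tmul, extendPrecomp_tmul,
      contract_tmul, contract_tmul]
    exact congrArg (fun k => N.obj.map (Quiver.Hom.op k) y) (h a b c f k)
  -- Write `y ⊗ f` as the pullback of `y ⊗ 1` along `f`, move the pullback past `g`, and exchange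
  -- `f` for `φ(α(f))`. Moving back inside, the pullback of `y ⊗ 1` along `φ(α(f))` is `M(α(f))(y) ⊗
  -- 1`.
  rw [AddMonoidHom.comp_apply, AddMonoidHom.comp_apply, contract_tmul, contractHom_app,
    extendTmul_eq_precomp, extendApp_precomp, key]
  exact congrArg (contract α N a) ((extendApp_precomp g (φ.map (bimodApp α a b f)) _).symm.trans
    (congrArg (extendApp g (φ.obj (ψ.obj a))) (extendUnit_map M (bimodApp α a b f) y).symm))

/-- This is `contract_extendApp` for the element `f(x ⊗ 1)`. -/
lemma contractHom_comp
    (h : ∀ (a : Q) (b c : R) (f : φ.obj (ψ.obj a) ⟶ φ.obj b) (g : φ.obj b ⟶ φ.obj c),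
      bimodApp α a c (f ≫ g) = bimodApp α a c (φ.map (bimodApp α a b f) ≫ g))
    {L M N : RightMod R} (f : (extendScalars φ).obj L ⟶ (extendScalars φ).obj M)
    (g : (extendScalars φ).obj M ⟶ (extendScalars φ).obj N) :
    contractHom α (f ≫ g) = contractHom α f ≫ contractHom α g :=
  restrictApp_ext fun a _ => contract_extendApp α h g a _

lemma isHeavilySeparable_of_bimod (h₁ : mapBimod ψ φ ≫ α = 𝟙 _)
    (h₂ : ∀ (a : Q) (b c : R) (f : φ.obj (ψ.obj a) ⟶ φ.obj b) (g : φ.obj b ⟶ φ.obj c),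
      bimodApp α a c (f ≫ g) = bimodApp α a c (φ.map (bimodApp α a b f) ≫ g)) :
    IsHeavilySeparable (extendScalars φ) (restrictScalars ψ) :=
  ⟨homTrans (fun g => contractHom α g) (fun p g q => contractHom_naturality α p g q),
    fun _ _ p => contractHom_map α h₁ p, fun _ _ _ f g => contractHom_comp α h₂ f g⟩

/-! #### From heavy separability to bimodule morphisms -/

section Eval

variable (P : (extendScalars φ).op.prod (extendScalars φ) ⋙ Functor.hom (RightMod S) ⟶
  (restrictScalars ψ).op.prod (restrictScalars ψ) ⋙ Functor.hom (RightMod Q))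

/-- The value at `1` of the map `R(ψ(a), ψ(a)) → R(ψ(a), b)` obtained by applying `P` to the
morphism `extendYoneda f`. -/
noncomputable def evalYoneda {a : Q} {b : R} (f : φ.obj (ψ.obj a) ⟶ φ.obj b) : ψ.obj a ⟶ b :=
  restrictYonedaApp (homApp P (extendYoneda f)) a (𝟙 (ψ.obj a))

lemma evalYoneda_add {a : Q} {b : R} (f g : φ.obj (ψ.obj a) ⟶ φ.obj b) :
    evalYoneda P (f + g) = evalYoneda P f + evalYoneda P g := by
  rw [evalYoneda, extendYoneda_add, homApp_add]
  rfl

/-- Naturality of `P` along `R(-, x)` moves the evaluation point from `1` to `x`. It stands in for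
the Yoneda lemma, as `ψ_* R(-, r)` need not be representable over `Q`. -/
lemma evalYoneda_map_comp {a : Q} {r b : R} (x : ψ.obj a ⟶ r) (f : φ.obj r ⟶ φ.obj b) :
    evalYoneda P (φ.map x ≫ f) = restrictYonedaApp (homApp P (extendYoneda f)) a x := by
  rw [evalYoneda, extendYoneda_comp, extendYoneda_map, homApp_map_comp, restrictYonedaApp_comp,
    restrictYonedaApp_map, Category.id_comp]

lemma evalYoneda_comp_map {a : Q} {b b' : R} (f : φ.obj (ψ.obj a) ⟶ φ.obj b) (g : b ⟶ b') :
    evalYoneda P (f ≫ φ.map g) = evalYoneda P f ≫ g := by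
  rw [evalYoneda, extendYoneda_comp, extendYoneda_map, homApp_comp_map, restrictYonedaApp_comp,
    restrictYonedaApp_map, evalYoneda]

/-- The two sides have different sources: naturality of `P` handles `g` and turns `u` into the
evaluation point `ψ(u)`; `Q`-linearity of the resulting module morphism then extracts `ψ(u)`. -/
lemma evalYoneda_naturality {a a' : Q} {b b' : R} (u : a' ⟶ a) (f : φ.obj (ψ.obj a) ⟶ φ.obj b)
    (g : b ⟶ b') :
    evalYoneda P (φ.map (ψ.map u) ≫ f ≫ φ.map g) = ψ.map u ≫ evalYoneda P f ≫ g := by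
  rw [← Category.assoc, evalYoneda_comp_map, evalYoneda_map_comp, evalYoneda, ← Category.assoc,
    ← restrictYonedaApp_naturality, Category.comp_id]

/-- The morphism of bimodules with components `evalYoneda P`. -/
noncomputable def evalYonedaBimod : homBimod (ψ ⋙ φ) φ ⟶ homBimod ψ (𝟭 R) :=
  bimodMk (fun _ _ => AddMonoidHom.mk' (fun f => evalYoneda P f) (evalYoneda_add P))
    (fun u f g => evalYoneda_naturality P u f g)

lemma bimodApp_evalYonedaBimod {a : Q} {b : R} (f : φ.obj (ψ.obj a) ⟶ φ.obj b) :
    bimodApp (evalYonedaBimod P) a b f = evalYoneda P f := rfl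

end Eval

lemma exists_bimod_of_isHeavilySeparable
    (h : IsHeavilySeparable (extendScalars φ) (restrictScalars ψ)) :
    ∃ α : homBimod (ψ ⋙ φ) φ ⟶ homBimod ψ (𝟭 R), mapBimod ψ φ ≫ α = 𝟙 (homBimod ψ (𝟭 R)) ∧
      ∀ (a : Q) (b c : R) (f : φ.obj (ψ.obj a) ⟶ φ.obj b) (g : φ.obj b ⟶ φ.obj c),
        bimodApp α a c (f ≫ g) = bimodApp α a c (φ.map (bimodApp α a b f) ≫ g) := by
  obtain ⟨P, hmap, hcomp⟩ := h
  have hmap' : ∀ {M N : RightMod R} (p : M ⟶ N),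
      homApp P ((extendScalars φ).map p) = (restrictScalars ψ).map p := fun p => hmap _ _ p
  have hcomp' : ∀ {L M N : RightMod R} (f : (extendScalars φ).obj L ⟶ (extendScalars φ).obj M)
      (g : (extendScalars φ).obj M ⟶ (extendScalars φ).obj N),
      homApp P (f ≫ g) = homApp P f ≫ homApp P g := fun f g => hcomp _ _ _ f g
  have hφ : ∀ {a : Q} {b : R} (f : ψ.obj a ⟶ b), evalYoneda P (φ.map f) = f := fun f => by
    rw [evalYoneda, extendYoneda_map, hmap', restrictYonedaApp_map, Category.id_comp]
  refine ⟨evalYonedaBimod P, ?_, fun a b c f g => ?_⟩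
  · ext X f
    exact hφ f
  -- With `f'`, `g'` the morphisms of extended representables given by `f`, `g`, both sides equal
  -- `P(g')` evaluated at `P(f')(1)`: the right one by `evalYoneda_map_comp`, the left one by
  -- multiplicativity of `P`.
  · rw [bimodApp_evalYonedaBimod, bimodApp_evalYonedaBimod, bimodApp_evalYonedaBimod,
      evalYoneda_map_comp, evalYoneda, extendYoneda_comp, hcomp', restrictYonedaApp_comp,
      evalYoneda]

end Scalars

end HeavySep

theorem mainTheorem4 {Q R S : Type u} [SmallCategory Q] [Preadditive Q]
    [SmallCategory R] [Preadditive R] [SmallCategory S] [Preadditive S]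
    (ψ : Q ⥤ R) (φ : R ⥤ S) [ψ.Additive] [φ.Additive] :
    HeavySep.IsHeavilySeparable (HeavySep.extendScalars φ) (HeavySep.restrictScalars ψ) ↔
      ∃ α : HeavySep.homBimod (ψ ⋙ φ) φ ⟶ HeavySep.homBimod ψ (𝟭 R),
        HeavySep.mapBimod ψ φ ≫ α = 𝟙 (HeavySep.homBimod ψ (𝟭 R)) ∧
        ∀ (a : Q) (b c : R) (f : φ.obj (ψ.obj a) ⟶ φ.obj b) (g : φ.obj b ⟶ φ.obj c),
          HeavySep.bimodApp α a c (f ≫ g) =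
            HeavySep.bimodApp α a c (φ.map (HeavySep.bimodApp α a b f) ≫ g) :=
  ⟨HeavySep.exists_bimod_of_isHeavilySeparable,
    fun ⟨α, h₁, h₂⟩ => HeavySep.isHeavilySeparable_of_bimod α h₁ h₂⟩
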